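/- For $k\in(0,1)$ let $K(k)=\int_0^{\pi/2}\frac{d\theta}{\sqrt{1-k^2\sin^2\theta}}$ be the complete elliptic integral of the first kind, let $p\mapsto \operatorname{am}p$ be the Jacobi amplitude of modulus $k$, i.e. the inverse function of $\varphi\mapsto\int_0^{\varphi}\frac{d\theta}{\sqrt{1-k^2\sin^2\theta}}$, let $\operatorname{sn}p=\sin\operatorname{am}p$, $\operatorname{cn}p=\cos\operatorname{am}p$, $\operatorname{dn}p=\sqrt{1-k^2\operatorname{sn}^2p}$ be the Jacobi elliptic functions of modulus $k$, and let $\operatorname{E}(p)=\int_0^{\operatorname{am}p}\sqrt{1-k^2\sin^2\theta}\,d\theta$. Put $$g_2(p)=2\operatorname{E}(p)-(2-k^2)p,$$ $$f_2^V(p,k)=\frac43\Big(\operatorname{dn}p\,\big(8k^2\operatorname{cn}^2p\,\operatorname{sn}^2p+g_2^2(p)(3-6\operatorname{sn}^2p)\big)+\operatorname{cn}p\,\operatorname{sn}p\,\big(g_2^3(p)-k^4p-2g_2(p)(4+k^2(1-6\operatorname{sn}^2p))\big)\Big).$$ The normalized Maxwell time (for the sub-Riemannian problem on the Cartan group, non-inflectional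 case) is $\mathbf t_2^V(k)=p_2^V(k)/K(k)$, where $p=p_2^V(k)$ is the first positive root of $f_2^V(p,k)=0$. **Lemma.** There exists $\tilde k\in(0,1)$ such that for all $k$ with $\tilde k<k<1$ the function $p\mapsto f_2^V(p,k)$ has a root in the interval $\big(K(k),\tfrac32K(k)\big]$. In particular, for all $\tilde k<k<1$ the first positive root $p_2^V(k)$ exists and $\mathbf t_2^V(k)\le\tfrac32$. -/

import Mathlib

namespace CartanMaxwell

/-- Incomplete elliptic integral of the first kind, amplitude `φ`, modulus `k`. -/
noncomputable def ellipticF (k φ : ℝ) : ℝ :=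
  ∫ θ in (0 : ℝ)..φ, 1 / Real.sqrt (1 - k ^ 2 * Real.sin θ ^ 2)

/-- Incomplete elliptic integral of the second kind, amplitude `φ`, modulus `k`. -/
noncomputable def ellipticE (k φ : ℝ) : ℝ :=
  ∫ θ in (0 : ℝ)..φ, Real.sqrt (1 - k ^ 2 * Real.sin θ ^ 2)

/-- Complete elliptic integral of the first kind. -/
noncomputable def ellipticK (k : ℝ) : ℝ := ellipticF k (Real.pi / 2)

/-- Elliptic amplitude: the inverse function of `φ ↦ ellipticF k φ`, which is a bijection of `ℝ`
for `|k| < 1` (see `ellipticF_bijective`). -/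
noncomputable def am (k p : ℝ) : ℝ := Function.invFun (ellipticF k) p

noncomputable def sn (k p : ℝ) : ℝ := Real.sin (am k p)

noncomputable def cn (k p : ℝ) : ℝ := Real.cos (am k p)

noncomputable def dn (k p : ℝ) : ℝ := Real.sqrt (1 - k ^ 2 * sn k p ^ 2)

/-- The incomplete elliptic integral of the second kind composed with the amplitude. -/
noncomputable def jacobiE (k p : ℝ) : ℝ := ellipticE k (am k p)

noncomputable def g2 (p k : ℝ) : ℝ := 2 * jacobiE k p - (2 - k ^ 2) * p

noncomputable def f2V (p k : ℝ) : ℝ :=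
  4 / 3 *
    (dn k p * (8 * k ^ 2 * cn k p ^ 2 * sn k p ^ 2 + g2 p k ^ 2 * (3 - 6 * sn k p ^ 2)) +
      cn k p * sn k p *
        (g2 p k ^ 3 - k ^ 4 * p - 2 * g2 p k * (4 + k ^ 2 * (1 - 6 * sn k p ^ 2))))

/-- The first positive root of `p ↦ f2V p k` (the infimum of the set of positive roots). -/
noncomputable def p2V (k : ℝ) : ℝ := sInf {p : ℝ | 0 < p ∧ f2V p k = 0}

/-- The normalized Maxwell time. -/
noncomputable def t2V (k : ℝ) : ℝ := p2V k / ellipticK k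

theorem radicand_pos {k : ℝ} (hk : |k| < 1) (θ : ℝ) : 0 < 1 - k ^ 2 * Real.sin θ ^ 2 := by
  have h1 : k ^ 2 < 1 := (sq_lt_one_iff_abs_lt_one k).2 hk
  nlinarith [Real.sin_sq_le_one θ, sq_nonneg k, sq_nonneg (Real.sin θ)]

theorem ellipticF_integrand_continuous {k : ℝ} (hk : |k| < 1) :
    Continuous fun θ : ℝ => 1 / Real.sqrt (1 - k ^ 2 * Real.sin θ ^ 2) := by
  refine Continuous.div (by fun_prop) (by fun_prop) fun θ => ?_
  exact (Real.sqrt_pos.2 (radicand_pos hk θ)).ne'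

theorem ellipticF_hasDerivAt {k : ℝ} (hk : |k| < 1) (φ : ℝ) :
    HasDerivAt (ellipticF k) (1 / Real.sqrt (1 - k ^ 2 * Real.sin φ ^ 2)) φ := by
  have hc := ellipticF_integrand_continuous hk
  exact intervalIntegral.integral_hasDerivAt_right (hc.intervalIntegrable _ _)
    hc.aestronglyMeasurable.stronglyMeasurableAtFilter hc.continuousAt

theorem ellipticF_sub_le {k : ℝ} (hk : |k| < 1) : Monotone fun φ => ellipticF k φ - φ := by
  refine monotone_of_hasDerivAt_nonneg
    (f' := fun φ => 1 / Real.sqrt (1 - k ^ 2 * Real.sin φ ^ 2) - 1)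
    (fun φ => (ellipticF_hasDerivAt hk φ).sub (hasDerivAt_id φ)) fun φ => ?_
  have h := Real.sqrt_pos.2 (radicand_pos hk φ)
  have h2 : Real.sqrt (1 - k ^ 2 * Real.sin φ ^ 2) ≤ 1 := by
    rw [Real.sqrt_le_one]
    nlinarith [mul_nonneg (sq_nonneg k) (sq_nonneg (Real.sin φ))]
  have := one_le_one_div h h2
  simpa using this

/-- For `|k| < 1` the incomplete integral of the first kind is invertible, so `am` is its inverse. -/
theorem ellipticF_bijective {k : ℝ} (hk : |k| < 1) : Function.Bijective (ellipticF k) := by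
  have hm := ellipticF_sub_le hk
  have h0 : ellipticF k 0 = 0 := by simp [ellipticF]
  have hc : Continuous (ellipticF k) :=
    continuous_iff_continuousAt.2 fun φ => (ellipticF_hasDerivAt hk φ).continuousAt
  constructor
  · have hs : StrictMono (ellipticF k) := fun a b hab => by
      have := hm hab.le
      simp only at this
      linarith
    exact hs.injective
  · refine hc.surjective ?_ ?_
    · refine Filter.tendsto_atTop_mono' _ ?_ Filter.tendsto_id
      filter_upwards [Filter.eventually_ge_atTop 0] with x hx
      have := hm hx
      simp only [h0] at this
      simp only [id]
      linarith
    · refine Filter.tendsto_atBot_mono' _ ?_ Filter.tendsto_id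
      filter_upwards [Filter.eventually_le_atBot 0] with x hx
      have := hm hx
      simp only [h0] at this
      simp only [id]
      linarith

theorem ellipticF_am {k : ℝ} (hk : |k| < 1) (p : ℝ) : ellipticF k (am k p) = p :=
  Function.invFun_eq ((ellipticF_bijective hk).2 p)

theorem am_ellipticF {k : ℝ} (hk : |k| < 1) (φ : ℝ) : am k (ellipticF k φ) = φ :=
  Function.leftInverse_invFun (ellipticF_bijective hk).1 φ

end CartanMaxwell

/-!
For `k` near `1` the function `p ↦ f2V p k` changes sign between `K(k)` and a point that exceeds
`K(k)` by at most `π / 2`; since `K(k) → ∞` as `k → 1`, that point is at most `3 / 2 * K(k)`.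

Everything is computed in the amplitude variable `φ`, with `p = ellipticF k φ`, where the elliptic
functions become trigonometric ones (`f2V_ellipticF`). At `φ = π / 2` only the term
`-4 * dn * g2 ^ 2` survives, and it is negative (`f2V_ellipticK_neg`). The second point is
`φ = π / 2 + arccos k`: there `sin φ = k` and `cos φ = -√(1 - k ^ 2)`, so `dn` and `|cn|` are of the
same order and the cubic term in `g2`, which tends to `-∞`, dominates with a positive sign
(`f2V_pos`). The integrand of `ellipticF` is at most `1 / √(1 - k ^ 2)` while `arccos k` is at most
`π / 2 * √(1 - k ^ 2)`, which bounds the distance to `K(k)` (`ellipticF_sub_ellipticK_le`).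
The growth of `K(k)` is the bound `K(k) ≥ -log √(1 - k ^ 2)` (`neg_log_le_ellipticK`).

That the infimum of the positive roots is attained and positive does not follow from continuity,
because `p = 0` is itself a root. The function is however real analytic in `φ`, as the elliptic
integrals are primitives of restrictions of holomorphic functions (`analyticAt_of_hasDerivAt_re`),
and it is not identically zero; so its root at `0` is isolated (`exists_isLeast_pos_root`).
-/

open Set Filter Topology

namespace CartanMaxwell

/-! ### Analyticity of the elliptic integrals -/

/-- A real primitive of the real part of a holomorphic function is real analytic: near `x` it
differs by a constant from the real part of a holomorphic primitive. -/
theorem analyticAt_of_hasDerivAt_re {g : ℂ → ℂ} {f : ℝ → ℝ} {x : ℝ} (hg : AnalyticAt ℂ g x)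
    (hf : ∀ᶠ t : ℝ in 𝓝 x, HasDerivAt f (g t).re t) : AnalyticAt ℝ f x := by
  obtain ⟨r, hr, hball⟩ := Metric.eventually_nhds_iff_ball.1 hg.eventually_analyticAt
  have hd : DifferentiableOn ℂ g (Metric.ball (x : ℂ) r) := fun z hz =>
    (hball z hz).differentiableAt.differentiableWithinAt
  obtain ⟨G, hG⟩ := hd.isExactOn_ball
  have hGa : AnalyticAt ℂ G x :=
    DifferentiableOn.analyticAt (s := Metric.ball (x : ℂ) r)
      (fun z hz => (hG z hz).differentiableAt.differentiableWithinAt)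
      (Metric.ball_mem_nhds _ hr)
  obtain ⟨s, hs, hsf⟩ := Metric.eventually_nhds_iff_ball.1 hf
  have hm : 0 < min r s := lt_min hr hs
  have hdiff : ∀ t ∈ Metric.ball x (min r s),
      HasDerivAt (fun t : ℝ => f t - (G t).re) 0 t := by
    intro t ht
    have h1 := hsf t (Metric.ball_subset_ball (min_le_right _ _) ht)
    have htr : (t : ℂ) ∈ Metric.ball (x : ℂ) r := by
      have := Metric.ball_subset_ball (min_le_left r s) ht
      rw [Metric.mem_ball, Complex.dist_eq, ← Complex.ofReal_sub, Complex.norm_real]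
      exact this
    have h2 := (hG t htr).real_of_complex
    exact (h1.sub h2).congr_deriv (sub_self _)
  have hconst : ∀ t ∈ Metric.ball x (min r s), f t - (G t).re = f x - (G x).re := fun t ht =>
    Metric.isOpen_ball.is_const_of_deriv_eq_zero (convex_ball x _).isPreconnected
      (fun t ht => (hdiff t ht).differentiableAt.differentiableWithinAt)
      (fun t ht => (hdiff t ht).deriv) ht (Metric.mem_ball_self hm)
  have ha : AnalyticAt ℝ (fun t : ℝ => (G t).re + (f x - (G x).re)) x :=
    hGa.re_ofReal.add analyticAt_const
  refine ha.congr ?_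
  filter_upwards [Metric.ball_mem_nhds x hm] with t ht
  linarith [hconst t ht]

/-- The extension of `θ ↦ √(1 - k ^ 2 * sin θ ^ 2)` to complex `θ` by the principal branch of the
square root; it is holomorphic near the real axis when `|k| < 1`. -/
noncomputable def complexRoot (k : ℝ) (z : ℂ) : ℂ :=
  (1 - (k : ℂ) ^ 2 * Complex.sin z ^ 2) ^ (1 / 2 : ℂ)

theorem complexRoot_ofReal {k : ℝ} (hk : |k| < 1) (x : ℝ) :
    complexRoot k x = (Real.sqrt (1 - k ^ 2 * Real.sin x ^ 2) : ℝ) := by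
  rw [Real.sqrt_eq_rpow, Complex.ofReal_cpow (radicand_pos hk x).le]
  simp [complexRoot]

theorem analyticAt_complexRoot {k : ℝ} (hk : |k| < 1) (x : ℝ) :
    AnalyticAt ℂ (complexRoot k) x := by
  refine AnalyticAt.cpow (by fun_prop) analyticAt_const (Or.inl ?_)
  have : (1 - (k : ℂ) ^ 2 * Complex.sin x ^ 2).re = 1 - k ^ 2 * Real.sin x ^ 2 := by
    rw [← Complex.ofReal_re (1 - k ^ 2 * Real.sin x ^ 2)]
    push_cast
    rfl
  rw [this]
  exact radicand_pos hk x

theorem analyticAt_radical {k : ℝ} (hk : |k| < 1) (x : ℝ) :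
    AnalyticAt ℝ (fun θ => Real.sqrt (1 - k ^ 2 * Real.sin θ ^ 2)) x := by
  simpa [complexRoot_ofReal hk] using (analyticAt_complexRoot hk x).re_ofReal

theorem ellipticE_hasDerivAt (k φ : ℝ) :
    HasDerivAt (ellipticE k) (Real.sqrt (1 - k ^ 2 * Real.sin φ ^ 2)) φ := by
  have hc : Continuous fun θ : ℝ => Real.sqrt (1 - k ^ 2 * Real.sin θ ^ 2) := by fun_prop
  exact intervalIntegral.integral_hasDerivAt_right (hc.intervalIntegrable _ _)
    hc.aestronglyMeasurable.stronglyMeasurableAtFilter hc.continuousAt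

theorem analyticAt_ellipticE {k : ℝ} (hk : |k| < 1) (x : ℝ) : AnalyticAt ℝ (ellipticE k) x := by
  refine analyticAt_of_hasDerivAt_re (analyticAt_complexRoot hk x) (Eventually.of_forall fun t => ?_)
  simpa [complexRoot_ofReal hk] using ellipticE_hasDerivAt k t

theorem analyticAt_ellipticF {k : ℝ} (hk : |k| < 1) (x : ℝ) : AnalyticAt ℝ (ellipticF k) x := by
  refine analyticAt_of_hasDerivAt_re (g := (complexRoot k)⁻¹)
    ((analyticAt_complexRoot hk x).inv ?_) (Eventually.of_forall fun t => ?_)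
  · rw [complexRoot_ofReal hk]
    exact_mod_cast (Real.sqrt_pos.2 (radicand_pos hk x)).ne'
  · rw [Pi.inv_apply, complexRoot_ofReal hk, ← Complex.ofReal_inv, Complex.ofReal_re, ← one_div]
    exact ellipticF_hasDerivAt hk t

/-! ### The function in the amplitude variable -/

/-- The elliptic functions at `p = ellipticF k φ` are trigonometric functions of `φ`. -/
theorem f2V_ellipticF {k : ℝ} (hk : |k| < 1) (φ : ℝ) :
    f2V (ellipticF k φ) k = 4 / 3 *
      (Real.sqrt (1 - k ^ 2 * Real.sin φ ^ 2) *
          (8 * k ^ 2 * Real.cos φ ^ 2 * Real.sin φ ^ 2 +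
            (2 * ellipticE k φ - (2 - k ^ 2) * ellipticF k φ) ^ 2 * (3 - 6 * Real.sin φ ^ 2)) +
        Real.cos φ * Real.sin φ *
          ((2 * ellipticE k φ - (2 - k ^ 2) * ellipticF k φ) ^ 3 - k ^ 4 * ellipticF k φ -
            2 * (2 * ellipticE k φ - (2 - k ^ 2) * ellipticF k φ) *
              (4 + k ^ 2 * (1 - 6 * Real.sin φ ^ 2)))) := by
  simp only [f2V, g2, dn, cn, sn, jacobiE, am_ellipticF hk]

theorem analyticAt_f2V_ellipticF {k : ℝ} (hk : |k| < 1) (φ : ℝ) :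
    AnalyticAt ℝ (fun φ => f2V (ellipticF k φ) k) φ := by
  have h1 := analyticAt_ellipticF hk φ
  have h2 := analyticAt_ellipticE hk φ
  have h3 := analyticAt_radical hk φ
  have h4 : AnalyticAt ℝ Real.sin φ := Real.analyticAt_sin
  have h5 : AnalyticAt ℝ Real.cos φ := Real.analyticAt_cos
  simp only [f2V_ellipticF hk]
  fun_prop

theorem strictMono_ellipticF {k : ℝ} (hk : |k| < 1) : StrictMono (ellipticF k) := fun a b hab => by
  have := ellipticF_sub_le hk hab.le
  simp only at this
  linarith

/-! ### Existence of a first positive root -/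

/-- The possible root at `0` is isolated by analyticity, so the positive roots form a closed set. -/
theorem exists_isLeast_pos_root {h : ℝ → ℝ} (ha : ∀ x, AnalyticAt ℝ h x) {a b : ℝ}
    (hne : h a ≠ 0) (hb : 0 < b) (hb0 : h b = 0) : ∃ c, IsLeast {x : ℝ | 0 < x ∧ h x = 0} c := by
  have hev : ∀ᶠ x in 𝓝[≠] (0 : ℝ), h x ≠ 0 := by
    by_contra hcon
    have hcon' : ∃ᶠ x in 𝓝[≠] (0 : ℝ), h x = 0 := hcon
    exact hne (AnalyticOnNhd.eqOn_zero_of_preconnected_of_frequently_eq_zero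
      (fun x _ => ha x) isPreconnected_univ (mem_univ 0)
      hcon' (mem_univ a))
  obtain ⟨ε, hε, hball⟩ := Metric.eventually_nhds_iff_ball.1 (eventually_nhdsWithin_iff.1 hev)
  have hT : {x : ℝ | 0 < x ∧ h x = 0} = Ici ε ∩ h ⁻¹' {0} := by
    ext x
    simp only [mem_ofPred_eq, mem_inter_iff, mem_Ici, mem_preimage, mem_singleton_iff]
    refine ⟨fun hx => ⟨?_, hx.2⟩, fun hx => ⟨hε.trans_le hx.1, hx.2⟩⟩
    by_contra! hlt
    exact hball x (by simpa [abs_of_pos hx.1] using hlt) hx.1.ne' hx.2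
  have hcont : Continuous h := continuous_iff_continuousAt.2 fun x => (ha x).continuousAt
  have hcl : IsClosed {x : ℝ | 0 < x ∧ h x = 0} :=
    hT ▸ isClosed_Ici.inter (isClosed_singleton.preimage hcont)
  exact ⟨_, hcl.isLeast_csInf ⟨b, hb, hb0⟩ ⟨0, fun x hx => hx.1.le⟩⟩

theorem isLeast_p2V {k : ℝ} (hk : |k| < 1) {p q : ℝ} (hq : f2V q k ≠ 0) (hp : 0 < p)
    (hp0 : f2V p k = 0) : IsLeast {p : ℝ | 0 < p ∧ f2V p k = 0} (p2V k) := by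
  have hF0 : ellipticF k 0 = 0 := by simp [ellipticF]
  have hpos : ∀ φ, 0 < ellipticF k φ ↔ 0 < φ := fun φ => by
    simpa [hF0] using (strictMono_ellipticF hk).lt_iff_lt (a := 0) (b := φ)
  obtain ⟨c, hc⟩ := exists_isLeast_pos_root (a := am k q) (b := am k p)
    (analyticAt_f2V_ellipticF hk) (by simpa [ellipticF_am hk] using hq)
    ((hpos _).1 (by rwa [ellipticF_am hk])) (by simpa [ellipticF_am hk] using hp0)
  have himg : {p : ℝ | 0 < p ∧ f2V p k = 0} =
      ellipticF k '' {φ : ℝ | 0 < φ ∧ f2V (ellipticF k φ) k = 0} := by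
    ext r
    constructor
    · intro hr
      exact ⟨am k r, ⟨(hpos _).1 (by rw [ellipticF_am hk]; exact hr.1),
        by rw [ellipticF_am hk]; exact hr.2⟩, ellipticF_am hk r⟩
    · rintro ⟨φ, hφ, rfl⟩
      exact ⟨(hpos _).2 hφ.1, hφ.2⟩
  have hl : IsLeast {p : ℝ | 0 < p ∧ f2V p k = 0} (ellipticF k c) :=
    himg ▸ (strictMono_ellipticF hk).monotone.map_isLeast hc
  have : p2V k = ellipticF k c := hl.csInf_eq
  rwa [this]

/-! ### Bounds for the elliptic integrals -/

theorem ellipticE_le {k φ : ℝ} (hφ : 0 ≤ φ) : ellipticE k φ ≤ φ := by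
  have hm : Monotone fun φ => φ - ellipticE k φ := by
    refine monotone_of_hasDerivAt_nonneg
      (fun φ => (hasDerivAt_id φ).sub (ellipticE_hasDerivAt k φ)) fun φ => ?_
    have : Real.sqrt (1 - k ^ 2 * Real.sin φ ^ 2) ≤ 1 := by
      rw [Real.sqrt_le_one]
      nlinarith [mul_nonneg (sq_nonneg k) (sq_nonneg (Real.sin φ))]
    simpa using this
  have := hm hφ
  simp only [ellipticE, intervalIntegral.integral_same] at this ⊢
  linarith

theorem neg_log_le_ellipticK {k : ℝ} (h0 : 0 < k) (h1 : k < 1) :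
    -Real.log (Real.sqrt (1 - k ^ 2)) ≤ ellipticK k := by
  have hk : |k| < 1 := by rwa [abs_of_pos h0]
  have hk2 : 0 < 1 - k ^ 2 := by nlinarith
  set c := Real.sqrt (1 - k ^ 2) with hc
  have hcp : 0 < c := Real.sqrt_pos.2 hk2
  have hcs : c ^ 2 = 1 - k ^ 2 := Real.sq_sqrt hk2.le
  have hcos : ∀ φ ∈ Icc (0 : ℝ) (Real.pi / 2), 0 ≤ Real.cos φ := fun φ hφ =>
    Real.cos_nonneg_of_mem_Icc ⟨by linarith [hφ.1, Real.pi_pos], hφ.2⟩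
  have hd : ∀ φ ∈ Icc (0 : ℝ) (Real.pi / 2),
      HasDerivAt (fun φ => ellipticF k φ + Real.log (c + Real.cos φ))
        (1 / Real.sqrt (1 - k ^ 2 * Real.sin φ ^ 2) + (-Real.sin φ) / (c + Real.cos φ)) φ := by
    intro φ hφ
    exact (ellipticF_hasDerivAt hk φ).add
      (((Real.hasDerivAt_cos φ).const_add c).log (by linarith [hcos φ hφ]))
  -- `-log (c + cos φ)` is a primitive of `sin φ / (c + cos φ)`, a lower bound for the integrand.
  have hmono : MonotoneOn (fun φ => ellipticF k φ + Real.log (c + Real.cos φ))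
      (Icc 0 (Real.pi / 2)) := by
    refine monotoneOn_of_deriv_nonneg (convex_Icc _ _)
      (fun φ hφ => (hd φ hφ).continuousAt.continuousWithinAt)
      (fun φ hφ => (hd φ (interior_subset hφ)).differentiableAt.differentiableWithinAt)
      fun φ hφ => ?_
    have hφ' := interior_subset hφ
    rw [(hd φ hφ').deriv]
    have hcφ := hcos φ hφ'
    have hrad := Real.sqrt_pos.2 (radicand_pos hk φ)
    -- The radicand is `c ^ 2 + k ^ 2 * cos φ ^ 2`, which is at most `(c + cos φ) ^ 2`.
    have hle : Real.sqrt (1 - k ^ 2 * Real.sin φ ^ 2) ≤ c + Real.cos φ := by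
      rw [Real.sqrt_le_left (by positivity)]
      nlinarith [Real.sin_sq_add_cos_sq φ, mul_nonneg hcp.le hcφ, sq_nonneg (Real.cos φ),
        mul_nonneg (sq_nonneg k) (sq_nonneg (Real.cos φ))]
    have h2 : Real.sin φ / (c + Real.cos φ) ≤ 1 / (c + Real.cos φ) :=
      div_le_div_of_nonneg_right (Real.sin_le_one φ) (by positivity)
    have h3 := one_div_le_one_div_of_le hrad hle
    rw [neg_div]
    linarith
  have hpi : (0 : ℝ) ≤ Real.pi / 2 := by positivity
  have := hmono ⟨le_rfl, hpi⟩ ⟨hpi, le_rfl⟩ hpi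
  have hlog : 0 ≤ Real.log (c + 1) := Real.log_nonneg (by linarith)
  have hF0 : ellipticF k 0 = 0 := by simp [ellipticF]
  simp only [hF0, Real.cos_zero, Real.cos_pi_div_two, add_zero] at this
  rw [ellipticK]
  linarith

theorem ellipticF_sub_ellipticK_le {k : ℝ} (h0 : 0 < k) (h1 : k < 1) :
    ellipticF k (Real.pi / 2 + Real.arccos k) - ellipticK k ≤ Real.pi / 2 := by
  have hk : |k| < 1 := by rwa [abs_of_pos h0]
  have hk2 : 0 < 1 - k ^ 2 := by nlinarith
  set c := Real.sqrt (1 - k ^ 2) with hc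
  have hcp : 0 < c := Real.sqrt_pos.2 hk2
  have hm : Monotone fun φ => φ / c - ellipticF k φ := by
    refine monotone_of_hasDerivAt_nonneg
      (fun φ => ((hasDerivAt_id φ).div_const c).sub (ellipticF_hasDerivAt hk φ)) fun φ => ?_
    have : c ≤ Real.sqrt (1 - k ^ 2 * Real.sin φ ^ 2) :=
      Real.sqrt_le_sqrt (by nlinarith [Real.sin_sq_le_one φ, sq_nonneg k])
    simpa using one_div_le_one_div_of_le hcp this
  have h := hm (le_add_of_nonneg_right (a := Real.pi / 2) (Real.arccos_nonneg k))
  -- Jordan's inequality at `arccos k`, whose sine is `c`, gives `arccos k ≤ π / 2 * c`.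
  have hs := Real.mul_le_sin (Real.arccos_nonneg k) (Real.arccos_le_pi_div_two.2 h0.le)
  rw [Real.sin_arccos, ← hc] at hs
  have hle : Real.arccos k / c ≤ Real.pi / 2 := by
    rw [div_le_iff₀ hcp]
    have := mul_le_mul_of_nonneg_left hs (by positivity : (0 : ℝ) ≤ Real.pi / 2)
    have e : Real.pi / 2 * (2 / Real.pi * Real.arccos k) = Real.arccos k := by
      field_simp
    linarith
  simp only [add_div] at h
  rw [ellipticK]
  linarith

/-! ### Signs of the function at the ends of an interval -/

theorem f2V_ellipticK_neg {k : ℝ} (h0 : 0 < k) (h1 : k < 1) (hK : Real.pi < ellipticK k) :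
    f2V (ellipticK k) k < 0 := by
  have hk : |k| < 1 := by rwa [abs_of_pos h0]
  have hE : ellipticE k (Real.pi / 2) ≤ Real.pi / 2 := ellipticE_le (by positivity)
  rw [ellipticK, f2V_ellipticF hk]
  rw [ellipticK] at hK
  have hd := Real.sqrt_pos.2 (radicand_pos hk (Real.pi / 2))
  simp only [Real.sin_pi_div_two, Real.cos_pi_div_two] at hd ⊢
  have hg : 2 * ellipticE k (Real.pi / 2) - (2 - k ^ 2) * ellipticF k (Real.pi / 2) < 0 := by
    have hk2 : 0 < 1 - k ^ 2 := by nlinarith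
    linarith [mul_pos hk2 (Real.pi_pos.trans hK)]
  have := mul_pos hd (pow_pos (neg_pos.2 hg) 2)
  nlinarith

/-- At `φ = π / 2 + arccos k` one has `dn ≤ 3 / 2 * |cn|`, so the term `cn * sn * g2 ^ 3`, positive
because `cn` and `g2` are negative, outweighs `-3 * dn * g2 ^ 2` as soon as `-g2 ≥ 11`; the bound
`18 ≤ K(k)` ensures this, since `-g2 ≥ K(k) - 2 * π`. -/
theorem f2V_pos {k : ℝ} (h0 : 1 / 2 ≤ k) (h1 : k < 1) (hK : 18 ≤ ellipticK k) :
    0 < f2V (ellipticF k (Real.pi / 2 + Real.arccos k)) k := by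
  have hk : |k| < 1 := by rwa [abs_of_pos (by linarith)]
  have hk2 : 0 < 1 - k ^ 2 := by nlinarith
  have ha := Real.arccos_nonneg k
  have ha' : Real.arccos k ≤ Real.pi / 2 := Real.arccos_le_pi_div_two.2 (by linarith)
  set φ := Real.pi / 2 + Real.arccos k with hφ
  have hsin : Real.sin φ = k := by
    rw [hφ, add_comm, Real.sin_add_pi_div_two, Real.cos_arccos (by linarith) h1.le]
  have hcos : Real.cos φ = -Real.sqrt (1 - k ^ 2) := by
    rw [hφ, add_comm, Real.cos_add_pi_div_two, Real.sin_arccos]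
  have hE : ellipticE k φ ≤ φ := ellipticE_le (by positivity)
  have hF : ellipticK k ≤ ellipticF k φ :=
    (strictMono_ellipticF hk).monotone (by rw [hφ]; linarith)
  rw [f2V_ellipticF hk, hsin, hcos]
  set c := Real.sqrt (1 - k ^ 2) with hc
  have hcp : 0 < c := Real.sqrt_pos.2 hk2
  have hcs : c ^ 2 = 1 - k ^ 2 := Real.sq_sqrt hk2.le
  have hd0 : 0 ≤ Real.sqrt (1 - k ^ 2 * k ^ 2) := Real.sqrt_nonneg _
  have hd : Real.sqrt (1 - k ^ 2 * k ^ 2) ≤ 3 / 2 * c := by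
    rw [Real.sqrt_le_left (by positivity)]
    nlinarith
  set d := Real.sqrt (1 - k ^ 2 * k ^ 2)
  obtain ⟨G, hG⟩ : ∃ G, 2 * ellipticE k φ - (2 - k ^ 2) * ellipticF k φ = -G :=
    ⟨_, (neg_neg _).symm⟩
  have hG11 : 11 ≤ G := by
    -- `φ ≤ π`, hence `-G ≤ 2 * φ - ellipticF k φ ≤ 2 * π - 18`.
    have : ellipticF k φ ≤ (2 - k ^ 2) * ellipticF k φ := by nlinarith
    linarith [Real.pi_lt_d2]
  rw [hG]
  set P := ellipticF k φ
  have hP : 0 ≤ P := by linarith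
  have hfirst : -(9 / 2 * c * G ^ 2) ≤
      d * (8 * k ^ 2 * (-c) ^ 2 * k ^ 2 + (-G) ^ 2 * (3 - 6 * k ^ 2)) := by
    have e1 : -(3 * G ^ 2) ≤ 8 * k ^ 2 * (-c) ^ 2 * k ^ 2 + (-G) ^ 2 * (3 - 6 * k ^ 2) := by
      have : 0 ≤ 8 * k ^ 2 * (-c) ^ 2 * k ^ 2 := by positivity
      nlinarith [mul_nonneg (sq_nonneg G) hk2.le]
    have e2 := mul_le_mul_of_nonneg_left e1 hd0
    have e3 := mul_le_mul_of_nonneg_right hd (by positivity : 0 ≤ 3 * G ^ 2)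
    linarith
  have hcubic : 9 * G ^ 2 < G ^ 3 - 10 * G := by
    nlinarith [mul_nonneg (sub_nonneg.2 hG11) (sub_nonneg.2 hG11)]
  have hbr : G ^ 3 - 10 * G ≤
      -((-G) ^ 3 - k ^ 4 * P - 2 * (-G) * (4 + k ^ 2 * (1 - 6 * k ^ 2))) := by
    have e1 : 4 + k ^ 2 * (1 - 6 * k ^ 2) ≤ 5 := by nlinarith [sq_nonneg (k ^ 2)]
    have e2 := mul_le_mul_of_nonneg_left e1 (by linarith : 0 ≤ 2 * G)
    have e3 : 0 ≤ k ^ 4 * P := by positivity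
    linarith
  have hsecond : 9 / 2 * c * G ^ 2 <
      -c * k * ((-G) ^ 3 - k ^ 4 * P - 2 * (-G) * (4 + k ^ 2 * (1 - 6 * k ^ 2))) := by
    have hX := hcubic.trans_le hbr
    set X := -((-G) ^ 3 - k ^ 4 * P - 2 * (-G) * (4 + k ^ 2 * (1 - 6 * k ^ 2)))
    have e1 : c * (1 / 2 * (9 * G ^ 2)) < c * (1 / 2 * X) := by gcongr
    have e2 : c * (1 / 2 * X) ≤ c * (k * X) := by
      have : 0 ≤ X := le_trans (by positivity) hX.le
      gcongr
    linarith
  linarith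

theorem eighteen_le_ellipticK {k : ℝ} (h0 : Real.sqrt (1 - Real.exp (-36)) < k) (h1 : k < 1) :
    18 ≤ ellipticK k := by
  have hk0 : 0 < k := (Real.sqrt_nonneg _).trans_lt h0
  have hlt : 1 - Real.exp (-36) < k ^ 2 := (Real.sqrt_lt' hk0).1 h0
  have hk2 : 0 < 1 - k ^ 2 := by nlinarith
  refine le_trans ?_ (neg_log_le_ellipticK hk0 h1)
  have := Real.log_le_log hk2 (by linarith : 1 - k ^ 2 ≤ Real.exp (-36))
  rw [Real.log_exp] at this
  rw [Real.log_sqrt hk2.le]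
  linarith

theorem exists_root_Ioc {k : ℝ} (h0 : 1 / 2 ≤ k) (h1 : k < 1) (hK : 18 ≤ ellipticK k) :
    ∃ p ∈ Ioc (ellipticK k) (3 / 2 * ellipticK k), f2V p k = 0 := by
  have hk : |k| < 1 := by rwa [abs_of_pos (by linarith)]
  have hneg := f2V_ellipticK_neg (by linarith) h1 (by linarith [Real.pi_lt_d2])
  have hpos := f2V_pos h0 h1 hK
  have hcont : ContinuousOn (fun φ => f2V (ellipticF k φ) k)
      (Icc (Real.pi / 2) (Real.pi / 2 + Real.arccos k)) := fun φ _ =>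
    (analyticAt_f2V_ellipticF hk φ).continuousAt.continuousWithinAt
  obtain ⟨φ, hφ, hφ0⟩ := intermediate_value_Ioo
    (le_add_of_nonneg_right (a := Real.pi / 2) (Real.arccos_nonneg k)) hcont ⟨hneg, hpos⟩
  refine ⟨ellipticF k φ, ⟨strictMono_ellipticF hk hφ.1, ?_⟩, hφ0⟩
  have := ellipticF_sub_ellipticK_le (by linarith) h1
  linarith [strictMono_ellipticF hk hφ.2, Real.pi_lt_d2]

end CartanMaxwell

theorem mainTheorem7 :
    ∃ k₀ : ℝ, 0 < k₀ ∧ k₀ < 1 ∧ ∀ k : ℝ, k₀ < k → k < 1 →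
      (∃ p ∈ Set.Ioc (CartanMaxwell.ellipticK k) (3 / 2 * CartanMaxwell.ellipticK k),
        CartanMaxwell.f2V p k = 0) ∧
      IsLeast {p : ℝ | 0 < p ∧ CartanMaxwell.f2V p k = 0} (CartanMaxwell.p2V k) ∧
      CartanMaxwell.t2V k ≤ 3 / 2 := by
  refine ⟨max (1 / 2) (Real.sqrt (1 - Real.exp (-36))), by positivity,
    max_lt (by norm_num) ?_, fun k h0 h1 => ?_⟩
  · rw [Real.sqrt_lt' one_pos]
    linarith [Real.exp_pos (-36)]
  have hhalf : 1 / 2 ≤ k := ((le_max_left _ _).trans_lt h0).le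
  have hk : |k| < 1 := by rwa [abs_of_pos (by linarith)]
  have hK := CartanMaxwell.eighteen_le_ellipticK ((le_max_right _ _).trans_lt h0) h1
  obtain ⟨p, hp, hp0⟩ := CartanMaxwell.exists_root_Ioc hhalf h1 hK
  have hppos : 0 < p := by linarith [hp.1]
  have hneg := CartanMaxwell.f2V_ellipticK_neg (by linarith) h1 (by linarith [Real.pi_lt_d2])
  have hl := CartanMaxwell.isLeast_p2V hk hneg.ne hppos hp0
  refine ⟨⟨p, hp, hp0⟩, hl, ?_⟩
  rw [CartanMaxwell.t2V, div_le_iff₀ (by linarith)]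
  exact (hl.2 ⟨hppos, hp0⟩).trans hp.2
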